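/- Let $q \in [1,\infty)$. There is a constant $C > 0$, depending only on $q$, with the following property. Let $p \in [1,\infty)$ and $0 < T < \infty$, let $(\Omega,\mathcal{F},(\mathcal{F}_t)_{t\in[0,T]},\mathbb{P})$ be a filtered probability space satisfying the usual conditions, and let $V = (V_t)_{t \in [0,T]}$ be an adapted process with almost surely càdlàg paths, taking values in a real normed space $(E,|\cdot|)$ (measurability of $E$-valued random variables being understood in the strong sense), such that $V_0 \in L^q$. Put $V_{0-} := V_0$ and $\Delta V_u := V_u - V_{u-}$. For a function $F$ of $0 \le s \le t \le T$ with values in $[0,\infty]$ write $$\|F\|_{p} := \Big( \sup_{0 = t_0 < t_1 < \cdots < t_n = T} \sum_{i=0}^{n-1} F(t_i,t_{i+1})^p \Big)^{1/p} \in [0,\infty],$$ the supremum being over all finite partitions of $[0,T]$. Define the following quantities in $[0,\infty]$, where conditional expectations of nonnegative random variables may take the value $\infty$: * $\|V\|_{p,q,\infty,[0,T]} := \|F\|_p$ with $F(s,t) = \big\| \mathbb{E}[ |V_t - V_s|^q \mid \mathcal{F}_s ] \big\|_{L^\infty}^{1/q}$; * $\|\Gamma\|_{p,\infty,[0,T]}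 := \|F\|_p$ with $F(s,t) = \|\Gamma_{s,t}\|_{L^\infty}$, where $\Gamma_{s,t} := \sup_{u \in [s,t]} |\Delta V_u|$; * $\|V\|_{\mathrm{BMO}^{p\text{-var}},[0,T]} := \|F\|_p$ with $F(s,t) = \rho_{s,t}(V) := \sup_{\sigma,\tau} \big\| \mathbb{E}[ |V_\tau - V_{\sigma-}| \mid \mathcal{F}_\sigma ] \big\|_{L^\infty}$, the supremum being over all stopping times $\sigma,\tau$ with $s \le \sigma \le \tau \le t$. Then $$\tfrac15 \|V\|_{\mathrm{BMO}^{p\text{-var}},[0,T]} \;\le\; \|V\|_{p,q,\infty,[0,T]} + \|\Gamma\|_{p,\infty,[0,T]} \;\le\; C\, \|V\|_{\mathrm{BMO}^{p\text{-var}},[0,T]} .$$ In particular, $V \in \mathrm{BMO}^{p\text{-var}}$ (the class of adapted càdlàg processes with $\|V\|_{\mathrm{BMO}^{p\text{-var}},[0,T]} < \infty$) if and only if $V \in V^pL^{q,\infty}$ (the class of càdlàg processes with $V_0 \in L^q$ and $\|V\|_{p,q,\infty,[0,T]} < \infty$) and $\|\Gamma\|_{p,\infty,[0,T]} < \infty$.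 -/

import Mathlib

open MeasureTheory Set Filter Topology
open scoped ENNReal NNReal

noncomputable section

namespace BMOVar

/-- The time interval `[0,T]`. -/
abbrev TimeInterval (T : ℝ) : Type := Set.Icc (0 : ℝ) T

/-- The time `0`, as an element of `[0,T]`. -/
def startTime {T : ℝ} (hT : 0 < T) : TimeInterval T := ⟨0, le_rfl, hT.le⟩

/-- The time `T`, as an element of `[0,T]`. -/
def endTime {T : ℝ} (hT : 0 < T) : TimeInterval T := ⟨T, hT.le, le_rfl⟩

/-- The usual conditions: the filtration is right-continuous and complete, i.e. each of its
σ-algebras contains every subset of a null set. -/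
structure UsualConditions {T : ℝ} {Ω : Type*} {mΩ : MeasurableSpace Ω}
    (ℱ : Filtration (TimeInterval T) mΩ) (P : Measure Ω) : Prop where
  rightContinuous : ℱ.IsRightContinuous
  complete : ∀ (t : TimeInterval T) (A : Set Ω), P A = 0 → MeasurableSet[ℱ t] A

/-- A path on `[0,T]` is càdlàg if it is right-continuous and has left limits. -/
def IsCadlag {T : ℝ} {E : Type*} [TopologicalSpace E] (x : TimeInterval T → E) : Prop :=
  ∀ t, ContinuousWithinAt x (Set.Ici t) t ∧ ∃ l, Tendsto x (𝓝[<] t) (𝓝 l)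

/-- A process `V` on `[0,T]` is càdlàg if almost all of its paths are. -/
def IsCadlagProcess {T : ℝ} {Ω E : Type*} {mΩ : MeasurableSpace Ω} [TopologicalSpace E]
    (P : Measure Ω) (V : TimeInterval T → Ω → E) : Prop :=
  ∀ᵐ ω ∂P, IsCadlag fun t => V t ω

/-- The left limit `V_{t-}(ω)`, with the convention `V_{0-} = V_0`. -/
def leftValue {T : ℝ} {Ω E : Type*} [TopologicalSpace E]
    (V : TimeInterval T → Ω → E) (t : TimeInterval T) (ω : Ω) : E :=
  Function.leftLim (fun u => V u ω) t

/-- `(sup_𝒫 ∑_{[u,v] ∈ 𝒫} (F u v)^p)^{1/p}`, where the supremum is taken over all partitions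
`s = t₀ < t₁ < ⋯ < tₙ = t` of `[s,t]`. -/
def pVariation {T : ℝ} (p : ℝ) (F : TimeInterval T → TimeInterval T → ℝ≥0∞)
    (s t : TimeInterval T) : ℝ≥0∞ :=
  (⨆ (n : ℕ) (π : Fin (n + 1) → TimeInterval T)
    (_ : StrictMono π ∧ π 0 = s ∧ π (Fin.last n) = t),
      ∑ i : Fin n, F (π i.castSucc) (π i.succ) ^ p) ^ (1 / p)

/-- `‖Y‖_{q,r,s} = ‖ 𝔼[|Y|^q | ℱ_s] ‖_{L^r}^{1/q}`, with value `∞` allowed. -/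
def condNorm {T : ℝ} {Ω E : Type*} {mΩ : MeasurableSpace Ω} [NormedAddCommGroup E]
    (ℱ : Filtration (TimeInterval T) mΩ) (P : Measure Ω) (q : ℝ) (r : ℝ≥0∞)
    (s : TimeInterval T) (Y : Ω → E) : ℝ≥0∞ :=
  eLpNorm (condLExp (ℱ s) P fun ω => ‖Y ω‖ₑ ^ q) r P ^ (1 / q)

/-- `‖V‖_{p,q,r,[s,t]}`: the `p`-variation over `[s,t]` of the increments of the process `V`,
where the increment `V_v - V_u` is measured by `‖·‖_{q,r,u}`. -/
def pqrNorm {T : ℝ} {Ω E : Type*} {mΩ : MeasurableSpace Ω} [NormedAddCommGroup E]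
    (ℱ : Filtration (TimeInterval T) mΩ) (P : Measure Ω) (p q : ℝ) (r : ℝ≥0∞)
    (V : TimeInterval T → Ω → E) (s t : TimeInterval T) : ℝ≥0∞ :=
  pVariation p (fun u v => condNorm ℱ P q r u (V v - V u)) s t

/-- `‖F‖_{p,∞,[s,t]}` for a two-parameter family `F` of `[0,∞]`-valued random variables. -/
def pInftyNorm {T : ℝ} {Ω : Type*} {mΩ : MeasurableSpace Ω} (P : Measure Ω) (p : ℝ)
    (F : TimeInterval T → TimeInterval T → Ω → ℝ≥0∞) (s t : TimeInterval T) : ℝ≥0∞ :=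
  pVariation p (fun u v => eLpNorm (F u v) ∞ P) s t

/-- `Γ_{s,t} = sup_{u ∈ [s,t]} |V_u - V_{u-}|`. -/
def jumpSup {T : ℝ} {Ω E : Type*} [NormedAddCommGroup E]
    (V : TimeInterval T → Ω → E) (s t : TimeInterval T) (ω : Ω) : ℝ≥0∞ :=
  ⨆ u ∈ Set.Icc s t, ‖V u ω - leftValue V u ω‖ₑ

/-- The modulus of mean variation `ρ_{s,t}(V) = sup ‖ 𝔼[|V_τ - V_{σ-}| | ℱ_σ] ‖_{L^∞}`, where
the supremum is taken over all stopping times `σ ≤ τ` with values in `[s,t]`. -/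
def meanVariation {T : ℝ} {Ω E : Type*} {mΩ : MeasurableSpace Ω} [NormedAddCommGroup E]
    (ℱ : Filtration (TimeInterval T) mΩ) (P : Measure Ω)
    (V : TimeInterval T → Ω → E) (s t : TimeInterval T) : ℝ≥0∞ :=
  ⨆ (σ : Ω → TimeInterval T) (τ : Ω → TimeInterval T)
    (hσ : IsStoppingTime ℱ fun ω => (σ ω : WithTop (TimeInterval T)))
    (_ : IsStoppingTime ℱ fun ω => (τ ω : WithTop (TimeInterval T)))
    (_ : ∀ ω, s ≤ σ ω ∧ σ ω ≤ τ ω ∧ τ ω ≤ t),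
    eLpNorm (condLExp hσ.measurableSpace P
      fun ω => ‖V (τ ω) ω - leftValue V (σ ω) ω‖ₑ) ∞ P

/-- `‖V‖_{BMO^{p-var},[s,t]}`: the `p`-variation over `[s,t]` of `(u,v) ↦ ρ_{u,v}(V)`. -/
def bmoNorm {T : ℝ} {Ω E : Type*} {mΩ : MeasurableSpace Ω} [NormedAddCommGroup E]
    (ℱ : Filtration (TimeInterval T) mΩ) (P : Measure Ω) (p : ℝ)
    (V : TimeInterval T → Ω → E) (s t : TimeInterval T) : ℝ≥0∞ :=
  pVariation p (meanVariation ℱ P V) s t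

/-- The class `BMO^{p-var}` of càdlàg adapted processes with `‖V‖_{BMO^{p-var},[0,T]} < ∞`. -/
structure MemBMO {T : ℝ} (hT : 0 < T) {Ω E : Type*} {mΩ : MeasurableSpace Ω}
    [NormedAddCommGroup E] (ℱ : Filtration (TimeInterval T) mΩ) (P : Measure Ω) (p : ℝ)
    (V : TimeInterval T → Ω → E) : Prop where
  cadlag : IsCadlagProcess P V
  adapted : StronglyAdapted ℱ V
  finite : bmoNorm ℱ P p V (startTime hT) (endTime hT) < ∞

/-- The space `V^p L^{q,r}` of càdlàg processes with `V_0 ∈ L^q` and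
`‖V‖_{p,q,r,[0,T]} < ∞`. -/
structure MemVpLqr {T : ℝ} (hT : 0 < T) {Ω E : Type*} {mΩ : MeasurableSpace Ω}
    [NormedAddCommGroup E] (ℱ : Filtration (TimeInterval T) mΩ) (P : Measure Ω)
    (p q : ℝ) (r : ℝ≥0∞) (V : TimeInterval T → Ω → E) : Prop where
  cadlag : IsCadlagProcess P V
  initial : MemLp (V (startTime hT)) (ENNReal.ofReal q) P
  finite : pqrNorm ℱ P p q r V (startTime hT) (endTime hT) < ∞

end BMOVar

end

/-! Both bounds are proved on a single interval `[s,t]` and then summed over partitions. An `L^∞`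
bound `c` on a conditional expectation of `X` is always used as `∫_A X ≤ c * P A` for all `A` in the
conditioning σ-algebra.

Upper bound, moments (`setLIntegral_rpow_le`). Let `R ≥ ρ_{s,t}`, and let `σ ≤ τ` be the exit times
from the balls of radii `c` and `c + 2R` around `V_s`. Just before `σ` the path is within `c` of
`V_s`, while at `τ`, if the larger ball is left, it is at distance at least `c + 2R`. Hence `|V_τ -
V_{σ-}| ≥ 2R` there, and Markov's inequality shows that at most half of the paths leaving the
smaller ball leave the larger one. The resulting geometric tail controls every moment.

Upper bound, jumps (`eLpNorm_jumpSup_le_meanVariation`). Seen from a time shortly before a jump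
larger than `μ > ρ_{s,t}`, the balls of radii `ε` and `ε + μ` are left simultaneously. This event
lies in `ℱ_σ` and `|V_τ - V_{σ-}| ≥ μ` on it, so it is null; countably many such events capture all
large jumps after time `s`.

Lower bound (`meanVariation_le`). Write `V_τ - V_{σ-} = -(V_t - V_τ) + (V_t - V_σ) + ΔV_σ`.
Discretising stopping times from the right, with Fatou and Jensen, bounds the first two terms by the
supremum over `u ∈ [s,t]` of the conditional norm of `V_t - V_u`. Superadditivity of the `p`-th
power of `p`-variation makes this supremum free (`pVariation_iSup_le`), giving the factor `2`,
better than `5`. -/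

namespace BMOVar

/-! ### Conditional expectations through set integrals -/

section CondLExp

variable {Ω : Type*} {m mΩ : MeasurableSpace Ω} {P : Measure Ω} [IsProbabilityMeasure P]

/-- A conditional expectation is essentially bounded by `c` as soon as the set integrals are. -/
lemma eLpNorm_condLExp_le (hm : m ≤ mΩ) {X : Ω → ℝ≥0∞} {c : ℝ≥0∞}
    (h : ∀ A, MeasurableSet[m] A → ∫⁻ ω in A, X ω ∂P ≤ c * P A) :
    eLpNorm (condLExp m P X) ∞ P ≤ c := by
  rw [eLpNorm_exponent_top]
  refine essSup_le_of_ae_le _ ?_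
  simp only [enorm_eq_self]
  apply ae_le_of_ae_le_trim (hm := hm)
  refine ae_le_of_forall_setLIntegral_le_of_sigmaFinite (measurable_condLExp m P X) ?_
  intro A hA _
  rw [setLIntegral_condLExp_trim hm P X hA]
  simpa [trim_measurableSet_eq hm hA] using h A hA

/-- Set integrals are bounded by the essential supremum of the conditional expectation. -/
lemma setLIntegral_le_eLpNorm_condLExp (hm : m ≤ mΩ) (X : Ω → ℝ≥0∞) {A : Set Ω}
    (hA : MeasurableSet[m] A) :
    ∫⁻ ω in A, X ω ∂P ≤ eLpNorm (condLExp m P X) ∞ P * P A := by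
  rw [← setLIntegral_condLExp hm P X hA, ← setLIntegral_const, eLpNorm_exponent_top]
  refine lintegral_mono_ae (ae_restrict_of_ae ?_)
  filter_upwards [ENNReal.ae_le_essSup fun ω => ‖condLExp m P X ω‖ₑ] with ω h
  simpa [eLpNormEssSup] using h

/-- Jensen's inequality on a set `A`. -/
lemma setLIntegral_le_of_setLIntegral_rpow_le {X : Ω → ℝ≥0∞} (hX : AEMeasurable X P) {q : ℝ}
    (hq : 1 ≤ q) {G : ℝ≥0∞} {A : Set Ω} (h : ∫⁻ ω in A, X ω ^ q ∂P ≤ G ^ q * P A) :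
    ∫⁻ ω in A, X ω ∂P ≤ G * P A := by
  have hq0 : 0 < q := by linarith
  have h1 := eLpNorm_le_eLpNorm_mul_rpow_measure_univ (μ := P.restrict A) (f := X)
    (p := 1) (q := ENNReal.ofReal q) (by simpa using hq) hX.restrict.aestronglyMeasurable
  have hq' : ENNReal.ofReal q ≠ 0 := by simpa using hq0
  rw [eLpNorm_one_eq_lintegral_enorm,
    eLpNorm_eq_lintegral_rpow_enorm_toReal hq' ENNReal.ofReal_ne_top] at h1
  simp only [enorm_eq_self, ENNReal.toReal_ofReal hq0.le, ENNReal.toReal_one,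
    Measure.restrict_apply_univ] at h1
  refine h1.trans ?_
  have hPA : P A ≠ ∞ := measure_ne_top _ _
  calc (∫⁻ ω in A, X ω ^ q ∂P) ^ (1 / q) * P A ^ (1 / 1 - 1 / q)
      ≤ (G ^ q * P A) ^ (1 / q) * P A ^ (1 / 1 - 1 / q) := by gcongr
    _ = G * P A := by
      rw [ENNReal.mul_rpow_of_nonneg _ _ (by positivity), ← ENNReal.rpow_mul,
        mul_one_div_cancel hq0.ne', ENNReal.rpow_one, mul_assoc,
        ← ENNReal.rpow_add_of_nonneg]
      · simp
      · positivity
      · rw [sub_nonneg, div_one]; exact (div_le_one hq0).2 hq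

end CondLExp

/-! ### Exit times from balls -/

section Hitting

variable {T : ℝ} {Ω E : Type*} {mΩ : MeasurableSpace Ω} [NormedAddCommGroup E]

/-- The times `u ∈ D ∩ [a,t]` at which the path has left the closed ball of radius `c` around
its value at time `a`. -/
def exitSet (V : TimeInterval T → Ω → E) (D : Set (TimeInterval T)) (a t : TimeInterval T)
    (c : ℝ≥0∞) (ω : Ω) : Set (TimeInterval T) :=
  {u | u ∈ D ∧ a ≤ u ∧ u ≤ t ∧ c < ‖V u ω - V a ω‖ₑ}

lemma exists_isGLB_insert (t : TimeInterval T) (S : Set (TimeInterval T)) :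
    ∃ x, IsGLB (insert t S) x := by
  have : Fact ((0 : ℝ) ≤ T) := ⟨t.2.1.trans t.2.2⟩
  exact ⟨_, isGLB_sInf _⟩

/-- The first exit time, along `D`, of the closed ball of radius `c` around the value at time `a`,
capped at `t`. -/
noncomputable def exitTime (V : TimeInterval T → Ω → E) (D : Set (TimeInterval T))
    (a t : TimeInterval T) (c : ℝ≥0∞) (ω : Ω) : TimeInterval T :=
  (exists_isGLB_insert t (exitSet V D a t c ω)).choose

/-- The event that the path leaves the ball before time `t`. -/
def exitEvent (V : TimeInterval T → Ω → E) (D : Set (TimeInterval T)) (a t : TimeInterval T)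
    (c : ℝ≥0∞) : Set Ω :=
  {ω | (exitSet V D a t c ω).Nonempty}

variable {V : TimeInterval T → Ω → E} {D : Set (TimeInterval T)} {a t : TimeInterval T}
  {c c' : ℝ≥0∞} {ω : Ω}

lemma isGLB_exitTime : IsGLB (insert t (exitSet V D a t c ω)) (exitTime V D a t c ω) :=
  (exists_isGLB_insert t (exitSet V D a t c ω)).choose_spec

lemma isGLB_exitTime_of_nonempty (h : (exitSet V D a t c ω).Nonempty) :
    IsGLB (exitSet V D a t c ω) (exitTime V D a t c ω) := by
  obtain ⟨u, hu⟩ := h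
  refine ⟨fun x hx => isGLB_exitTime.1 (mem_insert_of_mem _ hx), fun x hx =>
    isGLB_exitTime.2 ?_⟩
  rintro y (rfl | hy)
  · exact (hx hu).trans hu.2.2.1
  · exact hx hy

lemma exitTime_le : exitTime V D a t c ω ≤ t := isGLB_exitTime.1 (mem_insert _ _)

lemma le_exitTime (hat : a ≤ t) : a ≤ exitTime V D a t c ω := by
  refine isGLB_exitTime.2 ?_
  rintro y (rfl | hy)
  exacts [hat, hy.2.1]

lemma exitSet_anti (h : c ≤ c') : exitSet V D a t c' ω ⊆ exitSet V D a t c ω :=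
  fun _ hu => ⟨hu.1, hu.2.1, hu.2.2.1, h.trans_lt hu.2.2.2⟩

lemma exitTime_mono (h : c ≤ c') : exitTime V D a t c ω ≤ exitTime V D a t c' ω :=
  IsGLB.mono isGLB_exitTime isGLB_exitTime (insert_subset_insert (exitSet_anti h))

lemma exitTime_lt_iff {r : TimeInterval T} :
    exitTime V D a t c ω < r ↔ t < r ∨ ∃ u ∈ exitSet V D a t c ω, u < r := by
  rw [isGLB_lt_iff isGLB_exitTime]
  simp

variable {ℱ : Filtration (TimeInterval T) mΩ} {P : Measure Ω}

lemma measurableSet_exists_exitSet_lt (hV : StronglyAdapted ℱ V) (hD : D.Countable)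
    (r : TimeInterval T) : MeasurableSet[ℱ r] {ω | ∃ u ∈ exitSet V D a t c ω, u < r} := by
  have : {ω | ∃ u ∈ exitSet V D a t c ω, u < r} =
      ⋃ u ∈ D ∩ {u | a ≤ u ∧ u ≤ t ∧ u < r}, {ω | c < ‖V u ω - V a ω‖ₑ} := by
    ext ω
    simp only [exitSet, mem_ofPred_eq, mem_iUnion, mem_inter_iff, exists_prop]
    grind
  rw [this]
  refine MeasurableSet.biUnion (hD.mono inter_subset_left) fun u hu => ?_
  have h1 := ((hV u).mono (ℱ.mono hu.2.2.2.le)).sub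
    ((hV a).mono (ℱ.mono (hu.2.1.trans hu.2.2.2.le)))
  exact measurableSet_lt measurable_const h1.enorm

lemma measurableSet_exitEvent (hV : StronglyAdapted ℱ V) (hD : D.Countable) :
    MeasurableSet[ℱ t] (exitEvent V D a t c) := by
  have : exitEvent V D a t c =
      ⋃ u ∈ D ∩ {u | a ≤ u ∧ u ≤ t}, {ω | c < ‖V u ω - V a ω‖ₑ} := by
    ext ω
    simp only [exitEvent, Set.Nonempty, exitSet, mem_ofPred_eq, mem_iUnion, mem_inter_iff,
      exists_prop]
    grind
  rw [this]
  refine MeasurableSet.biUnion (hD.mono inter_subset_left) fun u hu => ?_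
  have h1 := ((hV u).mono (ℱ.mono hu.2.2)).sub ((hV a).mono (ℱ.mono (hu.2.1.trans hu.2.2)))
  exact measurableSet_lt measurable_const h1.enorm

/-- Countability of `D` puts the events of exit strictly before `r` in `ℱ r`; right-continuity of
the filtration upgrades `<` to `≤`. -/
lemma isStoppingTime_exitTime (hℱ : ℱ.IsRightContinuous) (hV : StronglyAdapted ℱ V)
    (hD : D.Countable) :
    IsStoppingTime ℱ fun ω => (exitTime V D a t c ω : WithTop (TimeInterval T)) := by
  have : Inhabited (TimeInterval T) := ⟨t⟩
  have key : ∀ r : TimeInterval T, MeasurableSet[ℱ r] {ω | exitTime V D a t c ω < r} := by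
    intro r
    simp only [exitTime_lt_iff]
    exact MeasurableSet.union (MeasurableSet.const _) (measurableSet_exists_exitSet_lt hV hD r)
  apply isStoppingTime_of_measurableSet_lt_of_isRightContinuous' (ι := TimeInterval T)
  · intro r
    simpa using key r
  -- A trivial right neighbourhood filter forces `r` to be the last time, where equality is the
  -- negation of `<`.
  · intro r hr
    have hmax : ∀ x : TimeInterval T, x ≤ r := by
      intro x
      by_contra! hx
      exact (nhdsGT_neBot_of_exists_gt ⟨x, hx⟩).ne hr
    convert (key r).compl using 1
    ext ω
    simp [le_antisymm_iff, hmax]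

/-- The exit time is capped at `t`, so a value below `t` already certifies that the ball was left.
-/
lemma measurableSet_exitEvent_exitTime (hℱ : ℱ.IsRightContinuous) (hV : StronglyAdapted ℱ V)
    (hD : D.Countable) : MeasurableSet[(isStoppingTime_exitTime (a := a) (t := t) (c := c)
      hℱ hV hD).measurableSpace] (exitEvent V D a t c) := by
  refine ⟨le_iSup (fun r => (ℱ r : MeasurableSpace Ω)) t _ (measurableSet_exitEvent hV hD),
    fun r => ?_⟩
  rcases le_or_gt t r with h | h
  · exact (ℱ.mono h _ (measurableSet_exitEvent hV hD)).inter
      (isStoppingTime_exitTime hℱ hV hD r)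
  · convert isStoppingTime_exitTime (a := a) (t := t) (c := c) hℱ hV hD r using 1
    rw [inter_eq_right]
    intro ω hω
    simp only [mem_ofPred_eq, WithTop.coe_le_coe] at hω
    obtain h' | ⟨u, hu, -⟩ := exitTime_lt_iff.1 (hω.trans_lt h)
    · exact absurd h' (lt_irrefl _)
    · exact ⟨u, hu⟩

lemma tendsto_leftValue (hx : IsCadlag fun u => V u ω) (u : TimeInterval T) :
    Tendsto (fun v => V v ω) (𝓝[<] u) (𝓝 (leftValue V u ω)) :=
  tendsto_leftLim_of_tendsto (hx u).2

lemma tendsto_enorm_sub (hx : IsCadlag fun u => V u ω) (u : TimeInterval T) (y : E) :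
    Tendsto (fun v => ‖V v ω - y‖ₑ) (𝓝[≥] u) (𝓝 ‖V u ω - y‖ₑ) :=
  ((continuous_enorm.tendsto _).comp ((hx u).1.tendsto.sub_const y) :)

/-- At the exit time the path has left the open ball. -/
lemma le_enorm_exitTime (hx : IsCadlag fun u => V u ω) (h : ω ∈ exitEvent V D a t c) :
    c ≤ ‖V (exitTime V D a t c ω) ω - V a ω‖ₑ := by
  by_contra! hlt
  have h1 := (tendsto_enorm_sub hx (exitTime V D a t c ω) (V a ω)).eventually_lt_const hlt
  obtain ⟨u, hu1, hu2⟩ := ((isGLB_exitTime_of_nonempty h).frequently_mem h).and_eventually h1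
    |>.exists
  exact lt_asymm hu2 hu1.2.2.2

/-- Right-continuity at `a` keeps the path in the ball for a while. Strictness leaves room for a
left limit at the exit time. -/
lemma lt_exitTime (hx : IsCadlag fun u => V u ω) (hat : a < t) (hc : 0 < c) :
    a < exitTime V D a t c ω := by
  refine lt_of_le_of_ne (le_exitTime hat.le) fun heq => ?_
  have h1 := (tendsto_enorm_sub hx a (V a ω)).eventually_lt_const (u := c) (by simpa using hc)
  have h2 : ∀ᶠ u in 𝓝[≥] a, u < t := nhdsWithin_le_nhds (eventually_lt_nhds hat)
  have hg := isGLB_exitTime (V := V) (D := D) (a := a) (t := t) (c := c) (ω := ω)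
  rw [← heq] at hg
  obtain ⟨u, hu, h3, h4⟩ := (hg.frequently_mem (insert_nonempty _ _)).and_eventually (h1.and h2)
    |>.exists
  rcases hu with rfl | hu
  · exact lt_irrefl _ h4
  · exact lt_asymm hu.2.2.2 h3

/-- Immediately before the exit time the path is still in the closed ball. -/
lemma enorm_leftValue_exitTime_le (hx : IsCadlag fun u => V u ω) (hD : Dense D) (hat : a < t)
    (hc : 0 < c) : ‖leftValue V (exitTime V D a t c ω) ω - V a ω‖ₑ ≤ c := by
  have ha := lt_exitTime (D := D) hx hat hc
  have h1 : Tendsto (fun v => ‖V v ω - V a ω‖ₑ) (𝓝[<] (exitTime V D a t c ω))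
      (𝓝 ‖leftValue V (exitTime V D a t c ω) ω - V a ω‖ₑ) :=
    (continuous_enorm.tendsto _).comp ((tendsto_leftValue hx _).sub_const _)
  refine isClosed_Iic.mem_of_frequently_of_tendsto (b := 𝓝[<] (exitTime V D a t c ω)) ?_ h1
  rw [Filter.frequently_iff]
  intro U hU
  obtain ⟨l, hl, hlU⟩ := (mem_nhdsLT_iff_exists_Ioo_subset' ha).1 hU
  obtain ⟨d, hdD, hd⟩ := hD.exists_between (max_lt hl ha)
  refine ⟨d, hlU ⟨(le_max_left _ _).trans_lt hd.1, hd.2⟩, ?_⟩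
  by_contra hcd
  refine absurd (isGLB_exitTime.1 (mem_insert_of_mem t (x := d) ⟨hdD, ?_, ?_, ?_⟩)) hd.2.not_ge
  · exact ((le_max_right _ _).trans_lt hd.1).le
  · exact hd.2.le.trans exitTime_le
  · exact not_le.1 hcd

end Hitting

/-! ### John–Nirenberg inequality for increments -/

section UpperBound

variable {T : ℝ} {Ω E : Type*} {mΩ : MeasurableSpace Ω} [NormedAddCommGroup E]
  {V : TimeInterval T → Ω → E} {D : Set (TimeInterval T)} {s a t : TimeInterval T}
  {ℱ : Filtration (TimeInterval T) mΩ} {P : Measure Ω} [IsProbabilityMeasure P]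

lemma setLIntegral_le_meanVariation {σ τ : Ω → TimeInterval T}
    (hσ : IsStoppingTime ℱ fun ω => (σ ω : WithTop (TimeInterval T)))
    (hτ : IsStoppingTime ℱ fun ω => (τ ω : WithTop (TimeInterval T)))
    (h : ∀ ω, s ≤ σ ω ∧ σ ω ≤ τ ω ∧ τ ω ≤ t) {A : Set Ω}
    (hA : MeasurableSet[hσ.measurableSpace] A) :
    ∫⁻ ω in A, ‖V (τ ω) ω - leftValue V (σ ω) ω‖ₑ ∂P ≤ meanVariation ℱ P V s t * P A := by
  refine (setLIntegral_le_eLpNorm_condLExp hσ.measurableSpace_le _ hA).trans ?_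
  gcongr
  exact le_iSup_of_le σ <| le_iSup_of_le τ <| le_iSup_of_le hσ <| le_iSup_of_le hτ <|
    le_iSup_of_le h le_rfl

-- Markov's inequality, arranged so that `X` need not be measurable.
omit [IsProbabilityMeasure P] in
lemma mul_measure_inter_le {A H : Set Ω} (hH : MeasurableSet H)
    {X : Ω → ℝ≥0∞} {μ : ℝ≥0∞} (h : ∀ᵐ ω ∂P, ω ∈ H → μ ≤ X ω) :
    μ * P (A ∩ H) ≤ ∫⁻ ω in A, X ω ∂P := by
  have : μ * P (A ∩ H) = ∫⁻ ω in A, H.indicator (fun _ => μ) ω ∂P := by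
    rw [lintegral_indicator_const hH, Measure.restrict_apply hH, inter_comm]
  rw [this]
  refine lintegral_mono_ae (ae_restrict_of_ae ?_)
  filter_upwards [h] with ω hω
  by_cases hωH : ω ∈ H <;> simp [hωH, hω]

lemma le_enorm_sub_leftValue_exitTime {c μ : ℝ≥0∞} {ω : Ω} (hx : IsCadlag fun u => V u ω)
    (hD : Dense D) (hat : a < t) (hc : 0 < c) (hc' : c ≠ ∞)
    (hω : ω ∈ exitEvent V D a t (c + μ)) :
    μ ≤ ‖V (exitTime V D a t (c + μ) ω) ω - leftValue V (exitTime V D a t c ω) ω‖ₑ := by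
  have h1 := le_enorm_exitTime hx hω
  have h2 := enorm_leftValue_exitTime_le hx hD hat hc
  set x := V (exitTime V D a t (c + μ) ω) ω
  set y := leftValue V (exitTime V D a t c ω) ω
  have h3 : ‖x - V a ω‖ₑ ≤ ‖x - y‖ₑ + ‖y - V a ω‖ₑ := by
    simpa using enorm_add_le (x - y) (y - V a ω)
  have h4 : c + μ ≤ c + ‖x - y‖ₑ := by
    rw [add_comm c ‖x - y‖ₑ]
    exact h1.trans (h3.trans (by gcongr))
  exact (ENNReal.add_le_add_iff_left hc').1 h4

/-- The probability of leaving a larger ball is controlled by that of leaving a smaller one. -/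
lemma mul_measure_exitEvent_le (hℱ : ℱ.IsRightContinuous) (hV : StronglyAdapted ℱ V)
    (hx : IsCadlagProcess P V) (hD : D.Countable) (hDd : Dense D)
    (hst : s < t) {c μ : ℝ≥0∞} (hc : 0 < c) (hc' : c ≠ ∞) {B : Set Ω}
    (hB : MeasurableSet[ℱ s] B) :
    μ * P (B ∩ exitEvent V D s t (c + μ)) ≤
      meanVariation ℱ P V s t * P (B ∩ exitEvent V D s t c) := by
  have hσ := isStoppingTime_exitTime (a := s) (t := t) (c := c) hℱ hV hD
  have hτ := isStoppingTime_exitTime (a := s) (t := t) (c := c + μ) hℱ hV hD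
  have hA : MeasurableSet[hσ.measurableSpace] (B ∩ exitEvent V D s t c) :=
    (hσ.le_measurableSpace_of_const_le
      (fun ω => by simpa using le_exitTime hst.le) _ hB).inter
      (measurableSet_exitEvent_exitTime hℱ hV hD)
  -- Leaving the larger ball entails leaving the smaller one, so the estimate can be localised to a
  -- set of `ℱ_σ`.
  have h1 : B ∩ exitEvent V D s t (c + μ) =
      (B ∩ exitEvent V D s t c) ∩ exitEvent V D s t (c + μ) := by
    rw [inter_assoc]
    congr 1
    refine (inter_eq_right.2 fun ω hω => ?_).symm
    exact hω.mono (exitSet_anti le_self_add)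
  rw [h1]
  refine (mul_measure_inter_le (ℱ.le t _ (measurableSet_exitEvent hV hD)) ?_).trans
    (setLIntegral_le_meanVariation hσ hτ (fun ω => ⟨le_exitTime hst.le,
      exitTime_mono le_self_add, exitTime_le⟩) hA)
  filter_upwards [hx] with ω hω hωH
  exact le_enorm_sub_leftValue_exitTime hω hDd hst hc hc' hωH

/-- The constant of the John–Nirenberg type inequality `setLIntegral_rpow_le`. -/
noncomputable def johnNirenbergConst (q : ℝ) : ℝ≥0∞ :=
  2 ^ q + ∑' k : ℕ, (2 * (k + 2 : ℝ≥0∞)) ^ q * 2⁻¹ ^ k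

lemma johnNirenbergConst_ne_top {q : ℝ} (hq : 0 ≤ q) : johnNirenbergConst q ≠ ∞ := by
  rw [johnNirenbergConst, ENNReal.add_ne_top]
  refine ⟨ENNReal.rpow_ne_top_of_nonneg hq (by simp), ?_⟩
  -- The bases `2 * (k + 2)` are at least `1`, so `q` may be rounded up to an integer.
  obtain ⟨n, hn⟩ := exists_nat_ge q
  have hs : Summable fun k : ℕ => (2 * ((k : ℝ) + 2)) ^ n * (1 / 2) ^ k := by
    have h := summable_pow_mul_geometric_of_norm_lt_one (R := ℝ) n (r := 1 / 2) (by norm_num)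
    have h2 := (((summable_nat_add_iff 2).2 h).mul_left (2 ^ n * 4))
    refine h2.congr fun k => ?_
    push_cast
    rw [mul_pow, pow_add]
    ring
  have h0 : ∀ k : ℕ, 0 ≤ (2 * ((k : ℝ) + 2)) ^ n * (1 / 2) ^ k := fun k => by positivity
  refine ne_top_of_le_ne_top (hs.tsum_ofReal_ne_top) (ENNReal.tsum_le_tsum fun k => ?_)
  rw [ENNReal.ofReal_mul (by positivity), ENNReal.ofReal_pow (by positivity),
    ENNReal.ofReal_pow (by positivity), ← ENNReal.rpow_natCast _ n]
  have e1 : ENNReal.ofReal (2 * ((k : ℝ) + 2)) = 2 * (k + 2 : ℝ≥0∞) := by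
    rw [ENNReal.ofReal_mul (by positivity), ENNReal.ofReal_add (by positivity) (by positivity)]
    simp
  have e2 : ENNReal.ofReal (1 / 2) = 2⁻¹ := by
    rw [one_div, ENNReal.ofReal_inv_of_pos (by norm_num)]
    simp
  rw [e1, e2]
  gcongr
  · calc (1 : ℝ≥0∞) ≤ 2 * (0 + 2) := by norm_num
      _ ≤ 2 * (k + 2) := by gcongr; simp

/-- John–Nirenberg type inequality for moments over sets of the `σ`-algebra at the initial time. -/
lemma setLIntegral_rpow_le (hℱ : ℱ.IsRightContinuous) (hV : StronglyAdapted ℱ V)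
    (hx : IsCadlagProcess P V) (hst : s < t) {q : ℝ} (hq : 0 ≤ q) {R : ℝ≥0} (hR : 0 < R)
    (hρ : meanVariation ℱ P V s t ≤ R) {B : Set Ω} (hB : MeasurableSet[ℱ s] B) :
    ∫⁻ ω in B, ‖V t ω - V s ω‖ₑ ^ q ∂P ≤ johnNirenbergConst q * R ^ q * P B := by
  obtain ⟨D₀, hD₀, hD₀d⟩ := TopologicalSpace.exists_countable_dense (TimeInterval T)
  -- With `t ∈ D`, the terminal value alone can witness an exit.
  set D := insert t D₀
  have hD : D.Countable := hD₀.insert t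
  have hDd : Dense D := hD₀d.mono (subset_insert _ _)
  have hR' : (R : ℝ≥0∞) ≠ 0 := by simpa using hR.ne'
  -- Spacing `2 * R` against a mean variation at most `R` gives the ratio `1/2`.
  let c : ℕ → ℝ≥0∞ := fun k => R * (2 * (k + 1))
  have hc : ∀ k, 0 < c k := fun k => by simp [c, hR]
  have hc' : ∀ k, c k ≠ ∞ := fun k => by
    simp only [c]
    finiteness
  have hcs : ∀ k, c (k + 1) = c k + 2 * R := fun k => by simp only [c]; push_cast; ring
  let H : ℕ → Set Ω := fun k => exitEvent V D s t (c k)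
  have hH : ∀ k, MeasurableSet (H k) := fun k => ℱ.le t _ (measurableSet_exitEvent hV hD)
  have hdecay : ∀ k, P (B ∩ H k) ≤ 2⁻¹ ^ k * P B := by
    intro k
    induction k with
    | zero => simpa using measure_mono inter_subset_left
    | succ k ih =>
      have h1 := mul_measure_exitEvent_le (μ := 2 * R) hℱ hV hx hD hDd hst (hc k) (hc' k) hB
      rw [← hcs] at h1
      have h2 : (R : ℝ≥0∞) * (2 * P (B ∩ H (k + 1))) ≤ R * P (B ∩ H k) := by
        calc (R : ℝ≥0∞) * (2 * P (B ∩ H (k + 1))) = 2 * R * P (B ∩ H (k + 1)) := by ring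
          _ ≤ _ := h1.trans (by gcongr)
      have h3 := (ENNReal.mul_le_mul_iff_right hR' ENNReal.coe_ne_top).1 h2
      calc P (B ∩ H (k + 1)) = 2⁻¹ * (2 * P (B ∩ H (k + 1))) := by
            rw [← mul_assoc, ENNReal.inv_mul_cancel (by simp) (by simp), one_mul]
        _ ≤ 2⁻¹ * (2⁻¹ ^ k * P B) := mul_le_mul_right (h3.trans ih) _
        _ = 2⁻¹ ^ (k + 1) * P B := by ring
  -- At the least `k` with increment at most `c k`, either `k = 0` or the term of index `k - 1`
  -- alone dominates.
  have hpt : ∀ ω, ‖V t ω - V s ω‖ₑ ^ q ≤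
      c 0 ^ q + ∑' k, (H k).indicator (fun _ => c (k + 1) ^ q) ω := by
    intro ω
    have hex : ∃ k, ‖V t ω - V s ω‖ₑ ≤ c k := by
      obtain ⟨n, hn⟩ := ENNReal.exists_nat_mul_gt hR' (b := ‖V t ω - V s ω‖ₑ) (by simp)
      refine ⟨n, hn.le.trans ?_⟩
      simp only [c]
      rw [mul_comm]
      gcongr
      calc (n : ℝ≥0∞) ≤ 2 * n := le_mul_of_one_le_left' (by norm_num)
        _ ≤ 2 * (n + 1) := by gcongr; simp
    classical
    have hsp := Nat.find_spec hex
    rcases hk : Nat.find hex with _ | k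
    · rw [hk] at hsp
      exact le_add_right (by gcongr)
    · rw [hk] at hsp
      have hlt : c k < ‖V t ω - V s ω‖ₑ := not_le.1 (Nat.find_min hex (by omega))
      have hωH : ω ∈ H k := ⟨t, mem_insert _ _, hst.le, le_rfl, hlt⟩
      refine le_add_left ((?_ : _ ≤ _).trans (ENNReal.le_tsum k))
      simp only [hωH, indicator_of_mem]
      gcongr
  calc ∫⁻ ω in B, ‖V t ω - V s ω‖ₑ ^ q ∂P
      ≤ ∫⁻ ω in B, c 0 ^ q + ∑' k, (H k).indicator (fun _ => c (k + 1) ^ q) ω ∂P :=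
        lintegral_mono hpt
    _ = c 0 ^ q * P B + ∑' k, c (k + 1) ^ q * P (B ∩ H k) := by
        rw [lintegral_add_left measurable_const, setLIntegral_const,
          lintegral_tsum fun k => (measurable_const.indicator (hH k)).aemeasurable]
        congr 2 with k
        rw [lintegral_indicator_const (hH k), Measure.restrict_apply (hH k), inter_comm]
    _ ≤ c 0 ^ q * P B + ∑' k, c (k + 1) ^ q * (2⁻¹ ^ k * P B) := by
        gcongr with k
        exact hdecay k
    _ = johnNirenbergConst q * R ^ q * P B := by
        have e : ∀ k : ℕ, c (k + 1) ^ q * (2⁻¹ ^ k * P B) =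
            (2 * (k + 2 : ℝ≥0∞)) ^ q * 2⁻¹ ^ k * (R ^ q * P B) := fun k => by
          simp only [c]
          rw [ENNReal.mul_rpow_of_nonneg _ _ hq]
          push_cast
          rw [add_assoc, one_add_one_eq_two]
          ring
        simp_rw [e]
        rw [ENNReal.tsum_mul_right, johnNirenbergConst]
        simp only [c]
        rw [ENNReal.mul_rpow_of_nonneg _ _ hq]
        push_cast
        rw [zero_add, mul_one]
        ring

/-- The moment bound needs a finite positive `R`, but the mean variation may be `0` or `∞`; hence
`R` decreases to it. -/
lemma condNorm_le_meanVariation (hℱ : ℱ.IsRightContinuous) (hV : StronglyAdapted ℱ V)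
    (hx : IsCadlagProcess P V) (hst : s < t) {q : ℝ} (hq : 0 < q) :
    condNorm ℱ P q ∞ s (V t - V s) ≤
      johnNirenbergConst q ^ (1 / q) * meanVariation ℱ P V s t := by
  have hK : johnNirenbergConst q ^ (1 / q) ≠ ∞ :=
    ENNReal.rpow_ne_top_of_nonneg (by positivity) (johnNirenbergConst_ne_top hq.le)
  have hK0 : johnNirenbergConst q ^ (1 / q) ≠ 0 := by
    rw [johnNirenbergConst]
    simp [hq, hq.le, ENNReal.rpow_eq_zero_iff]
  rw [mul_comm, ← ENNReal.div_le_iff hK0 hK]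
  refine le_of_forall_gt fun r hr => ?_
  obtain ⟨R, hR1, hR2⟩ := ENNReal.lt_iff_exists_nnreal_btwn.1 hr
  refine lt_of_le_of_lt ?_ hR2
  have hR : 0 < R := by
    simpa using (zero_le (a := meanVariation ℱ P V s t)).trans_lt hR1
  rw [ENNReal.div_le_iff hK0 hK]
  have h := eLpNorm_condLExp_le (P := P) (ℱ.le s) (X := fun ω => ‖(V t - V s) ω‖ₑ ^ q)
    fun A hA => setLIntegral_rpow_le hℱ hV hx hst hq.le hR hR1.le hA
  calc condNorm ℱ P q ∞ s (V t - V s) ≤ (johnNirenbergConst q * R ^ q) ^ (1 / q) := by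
        rw [condNorm]; gcongr
    _ = R * johnNirenbergConst q ^ (1 / q) := by
        rw [ENNReal.mul_rpow_of_nonneg _ _ (by positivity), ← ENNReal.rpow_mul,
          mul_one_div_cancel hq.ne', ENNReal.rpow_one, mul_comm]

end UpperBound

/-! ### Jumps are bounded by the mean variation -/

section Jumps

variable {T : ℝ} {Ω E : Type*} {mΩ : MeasurableSpace Ω} [NormedAddCommGroup E]
  {V : TimeInterval T → Ω → E} {D : Set (TimeInterval T)} {s a t : TimeInterval T}
  {ℱ : Filtration (TimeInterval T) mΩ} {P : Measure Ω} [IsProbabilityMeasure P]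

/-- The event that the path started at time `a` leaves the ball of radius `ε` and the ball of
radius `ε + μ` at the same time is null when `μ` exceeds the mean variation. -/
lemma measure_exitEvent_inter_exitTime_le_eq_zero (hℱ : ℱ.IsRightContinuous)
    (hV : StronglyAdapted ℱ V) (hx : IsCadlagProcess P V) (hD : D.Countable) (hDd : Dense D)
    (hsa : s ≤ a) (hat : a < t) {ε μ : ℝ≥0∞} (hε : 0 < ε) (hε' : ε ≠ ∞)
    (hμ : meanVariation ℱ P V s t < μ) :
    P (exitEvent V D a t (ε + μ) ∩
      {ω | exitTime V D a t (ε + μ) ω ≤ exitTime V D a t ε ω}) = 0 := by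
  have hσ := isStoppingTime_exitTime (a := a) (t := t) (c := ε) hℱ hV hD
  have hτ := isStoppingTime_exitTime (a := a) (t := t) (c := ε + μ) hℱ hV hD
  set J := exitEvent V D a t (ε + μ) ∩ {ω | exitTime V D a t (ε + μ) ω ≤ exitTime V D a t ε ω}
  -- An event of `ℱ_τ` intersected with `τ ≤ σ` belongs to `ℱ_σ`.
  have hJ : MeasurableSet[hσ.measurableSpace] J := by
    have h := IsStoppingTime.measurableSet_inter_le hτ hσ _
      (measurableSet_exitEvent_exitTime hℱ hV hD)
    rw [IsStoppingTime.measurableSet_min_iff hτ hσ] at h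
    simpa [J] using h.2
  have hJ' := hσ.measurableSpace_le _ hJ
  have h1 : μ * P (J ∩ J) ≤ meanVariation ℱ P V s t * P J := by
    refine (mul_measure_inter_le hJ' ?_).trans (setLIntegral_le_meanVariation hσ hτ
      (fun ω => ⟨hsa.trans (le_exitTime hat.le), exitTime_mono le_self_add, exitTime_le⟩) hJ)
    filter_upwards [hx] with ω hω hωJ
    exact le_enorm_sub_leftValue_exitTime hω hDd hat hε hε' hωJ.1
  rw [inter_self] at h1
  by_contra h0
  exact absurd ((ENNReal.mul_le_mul_iff_left h0 (measure_ne_top _ _)).1 h1) hμ.not_ge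

/-- A jump larger than `μ` is seen by exit times started shortly before it. -/
lemma exists_mem_exitEvent_of_lt_jump {ω : Ω} (hx : IsCadlag fun u => V u ω) (hDd : Dense D)
    (htD : t ∈ D) {u : TimeInterval T} (hsu : s < u) (hut : u ≤ t) {μ : ℝ≥0∞}
    (hμ : μ < ‖V u ω - leftValue V u ω‖ₑ) :
    ∃ a ∈ D, s ≤ a ∧ a < t ∧ ∃ n : ℕ, ω ∈ exitEvent V D a t ((n + 1 : ℝ≥0∞)⁻¹ + μ) ∩
      {ω | exitTime V D a t ((n + 1 : ℝ≥0∞)⁻¹ + μ) ω ≤ exitTime V D a t (n + 1 : ℝ≥0∞)⁻¹ ω} := by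
  set d := leftValue V u ω with hd
  -- The slack is spent twice: on the radius `ε`, and on replacing the left limit `d` by `V a ω`.
  obtain ⟨n, hn⟩ : ∃ n : ℕ, μ + 2 * (n + 1 : ℝ≥0∞)⁻¹ < ‖V u ω - d‖ₑ := by
    have hlim : Tendsto (fun n : ℕ => μ + 2 * ((n + 1 : ℕ) : ℝ≥0∞)⁻¹) atTop (𝓝 (μ + 2 * 0)) :=
      tendsto_const_nhds.add (ENNReal.Tendsto.const_mul
        ((tendsto_add_atTop_iff_nat 1).2 ENNReal.tendsto_inv_nat_nhds_zero) (by simp))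
    rw [mul_zero, add_zero] at hlim
    obtain ⟨n, hn⟩ := (hlim.eventually_lt_const hμ).exists
    exact ⟨n, by simpa using hn⟩
  set ε : ℝ≥0∞ := (n + 1 : ℝ≥0∞)⁻¹
  have hε : 0 < ε := by simp [ε]
  have hε' : ε ≠ ∞ := by simp [ε]
  have hl : Tendsto (fun v => ‖V v ω - d‖ₑ) (𝓝[<] u) (𝓝 0) := by
    have := (continuous_enorm.tendsto _).comp ((tendsto_leftValue hx u).sub_const d)
    simpa [← hd, Function.comp_def] using this
  obtain ⟨l, hlu, hl⟩ := (mem_nhdsLT_iff_exists_Ioo_subset' hsu).1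
    (hl.eventually_lt_const (ENNReal.half_pos hε.ne'))
  obtain ⟨a, haD, ha⟩ := hDd.exists_between (max_lt hlu hsu)
  have hlt : ∀ w, a ≤ w → w < u → ‖V w ω - d‖ₑ < ε / 2 := fun w haw hwu =>
    hl ⟨((le_max_left _ _).trans_lt ha.1).trans_le haw, hwu⟩
  have hua : ε + μ < ‖V u ω - V a ω‖ₑ := by
    have h1 : ‖V u ω - d‖ₑ ≤ ‖V u ω - V a ω‖ₑ + ‖V a ω - d‖ₑ := by
      simpa using enorm_add_le (V u ω - V a ω) (V a ω - d)
    have h2 : ‖V a ω - d‖ₑ ≤ ε := ((hlt a le_rfl ha.2).trans_le ENNReal.half_le_self).le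
    have h3 : (ε + μ) + ε < ‖V u ω - V a ω‖ₑ + ε := by
      calc (ε + μ) + ε = μ + 2 * ε := by ring
        _ < _ := hn
        _ ≤ _ := h1
        _ ≤ _ := by gcongr
    exact lt_of_add_lt_add_right h3
  -- On `[a,u)` all values are within `ε / 2` of `d`, hence within `ε` of each other.
  have hlow : u ≤ exitTime V D a t ε ω := by
    refine isGLB_exitTime.2 ?_
    rintro w (rfl | hw)
    · exact hut
    · by_contra! hwu
      refine absurd hw.2.2.2 (not_lt.2 ?_)
      calc ‖V w ω - V a ω‖ₑ ≤ ‖V w ω - d‖ₑ + ‖V a ω - d‖ₑ := by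
            simpa using enorm_sub_le (a := V w ω - d) (b := V a ω - d)
        _ ≤ ε / 2 + ε / 2 := add_le_add (hlt w hw.2.1 hwu).le (hlt a le_rfl ha.2).le
        _ = ε := ENNReal.add_halves ε
  -- Right-continuity provides times of `D` just after `u` outside the larger ball; for `u = t`
  -- there is no room, and `t ∈ D` is used.
  have hexit : ∀ w, u < w → ∃ v ∈ exitSet V D a t (ε + μ) ω, v < w := by
    intro w huw
    have h1 := (tendsto_enorm_sub hx u (V a ω)).eventually_const_lt hua
    rcases hut.eq_or_lt with rfl | hut
    · exact ⟨u, ⟨htD, ha.2.le, le_rfl, hua⟩, huw⟩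
    · obtain ⟨r, hr, hru⟩ := (mem_nhdsGE_iff_exists_Ico_subset' huw).1 h1
      obtain ⟨v, hvD, hv⟩ := hDd.exists_between (lt_min (lt_min hr huw) hut)
      simp only [mem_Ioo, lt_min_iff] at hv
      exact ⟨v, ⟨hvD, (ha.2.trans hv.1).le, hv.2.2.le, hru ⟨hv.1.le, hv.2.1.1⟩⟩, hv.2.1.2⟩
  refine ⟨a, haD, ((le_max_right _ _).trans_lt ha.1).le, ha.2.trans_le hut, n, ?_, ?_⟩
  · rcases hut.eq_or_lt with rfl | hut
    · exact ⟨u, htD, ha.2.le, le_rfl, hua⟩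
    · obtain ⟨v, hv, -⟩ := hexit t hut
      exact ⟨v, hv⟩
  · refine le_trans (le_of_forall_gt fun w huw => ?_) hlow
    exact exitTime_lt_iff.2 (Or.inr (hexit w huw))

omit [IsProbabilityMeasure P] in
lemma exists_seq_tendsto_leftValue (hx : IsCadlagProcess P V) (s : TimeInterval T) :
    ∃ r : ℕ → TimeInterval T, (∀ n, r n ≤ s) ∧
      ∀ᵐ ω ∂P, Tendsto (fun n => V (r n) ω) atTop (𝓝 (leftValue V s ω)) := by
  rcases eq_or_neBot (𝓝[<] s) with hs | hs
  · refine ⟨fun _ => s, fun _ => le_rfl, ae_of_all _ fun ω => ?_⟩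
    rw [leftValue, leftLim_eq_of_eq_bot _ hs]
    exact tendsto_const_nhds
  · obtain ⟨r, hr⟩ := exists_seq_tendsto (𝓝[<] s)
    obtain ⟨N, hN⟩ := eventually_atTop.1 (hr.eventually self_mem_nhdsWithin)
    refine ⟨fun n => r (n + N), fun n => (hN _ (Nat.le_add_left _ _)).le, ?_⟩
    filter_upwards [hx] with ω hω
    exact (tendsto_leftValue hω s).comp ((tendsto_add_atTop_iff_nat N).2 hr)

/-- The jump at the initial time is bounded by the mean variation. -/
lemma ae_jump_le_meanVariation (hV : StronglyAdapted ℱ V) (hx : IsCadlagProcess P V)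
    (hst : s ≤ t) :
    ∀ᵐ ω ∂P, ‖V s ω - leftValue V s ω‖ₑ ≤ meanVariation ℱ P V s t := by
  obtain ⟨r, hr, hlim⟩ := exists_seq_tendsto_leftValue hx s
  -- An `ℱ s`-measurable version of the jump at `s`, to be tested with `σ = τ = s`.
  set g : Ω → ℝ≥0∞ := fun ω => liminf (fun n => ‖V s ω - V (r n) ω‖ₑ) atTop
  have hg : Measurable[ℱ s] g := by
    refine Measurable.liminf fun n => ?_
    exact ((hV s).sub ((hV (r n)).mono (ℱ.mono (hr n)))).enorm
  have hfg : ∀ᵐ ω ∂P, ‖V s ω - leftValue V s ω‖ₑ = g ω := by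
    filter_upwards [hlim] with ω hω
    exact (((continuous_enorm.tendsto _).comp (hω.const_sub (V s ω))).liminf_eq).symm
  have hσ := isStoppingTime_const ℱ s
  have h2 : g ≤ᵐ[P] fun _ => meanVariation ℱ P V s t := by
    apply ae_le_of_ae_le_trim (hm := ℱ.le s)
    refine ae_le_of_forall_setLIntegral_le_of_sigmaFinite hg fun A hA _ => ?_
    rw [setLIntegral_trim (ℱ.le s) hg hA, setLIntegral_const, trim_measurableSet_eq (ℱ.le s) hA,
      ← lintegral_congr_ae (ae_restrict_of_ae hfg)]
    refine setLIntegral_le_meanVariation hσ hσ (fun _ => ⟨le_rfl, le_rfl, hst⟩) ?_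
    rwa [IsStoppingTime.measurableSpace_const]
  filter_upwards [hfg, h2] with ω h3 h4
  exact h3.trans_le h4

lemma eLpNorm_jumpSup_le_meanVariation (hℱ : ℱ.IsRightContinuous) (hV : StronglyAdapted ℱ V)
    (hx : IsCadlagProcess P V) (hst : s ≤ t) :
    eLpNorm (jumpSup V s t) ∞ P ≤ meanVariation ℱ P V s t := by
  obtain ⟨D₀, hD₀, hD₀d⟩ := TopologicalSpace.exists_countable_dense (TimeInterval T)
  set D := insert t D₀
  have hD : D.Countable := hD₀.insert t
  have hDd : Dense D := hD₀d.mono (subset_insert _ _)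
  refine le_of_forall_gt_imp_ge_of_dense fun μ hμ => ?_
  rw [eLpNorm_exponent_top]
  refine essSup_le_of_ae_le _ ?_
  have hnull : ∀ᵐ ω ∂P, ∀ a ∈ D ∩ Ico s t, ∀ n : ℕ,
      ω ∉ exitEvent V D a t ((n + 1 : ℝ≥0∞)⁻¹ + μ) ∩
        {ω | exitTime V D a t ((n + 1 : ℝ≥0∞)⁻¹ + μ) ω ≤ exitTime V D a t (n + 1 : ℝ≥0∞)⁻¹ ω} := by
    refine (ae_ball_iff (hD.mono inter_subset_left)).2 fun a ha => ae_all_iff.2 fun n => ?_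
    refine measure_eq_zero_iff_ae_notMem.1 ?_
    exact measure_exitEvent_inter_exitTime_le_eq_zero hℱ hV hx hD hDd ha.2.1 ha.2.2
      (by simp) (by simp) hμ
  filter_upwards [hnull, hx, ae_jump_le_meanVariation hV hx hst] with ω h1 h2 h3
  rw [enorm_eq_self]
  refine iSup₂_le fun u hu => ?_
  rcases hu.1.eq_or_lt with rfl | hsu
  · exact h3.trans hμ.le
  · by_contra! hlt
    obtain ⟨a, haD, hsa, hat, n, hn⟩ :=
      exists_mem_exitEvent_of_lt_jump h2 hDd (mem_insert _ _) hsu hu.2 hlt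
    exact h1 a ⟨haD, hsa, hat⟩ n hn

end Jumps

/-! ### From deterministic times to stopping times -/

section LowerBound

variable {T : ℝ} {Ω E : Type*} {mΩ : MeasurableSpace Ω} [NormedAddCommGroup E]
  {V : TimeInterval T → Ω → E} {s t : TimeInterval T}
  {ℱ : Filtration (TimeInterval T) mΩ} {P : Measure Ω} {σ τ : Ω → TimeInterval T}

/-- A stopping time bounded by `t` is a limit from the right of times with finitely many values,
which are adapted to the filtration. -/
lemma exists_finite_approximation
    (hσ : IsStoppingTime ℱ fun ω => (σ ω : WithTop (TimeInterval T))) (hσt : ∀ ω, σ ω ≤ t) :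
    ∃ (F : ℕ → Finset (TimeInterval T)) (σ' : ℕ → Ω → TimeInterval T),
      (∀ n ω, σ' n ω ∈ F n ∧ σ ω ≤ σ' n ω ∧ σ' n ω ≤ t) ∧
      (∀ n u A, MeasurableSet[hσ.measurableSpace] A →
        MeasurableSet[ℱ u] (A ∩ {ω | σ' n ω = u})) ∧
      ∀ ω, Tendsto (fun n => σ' n ω) atTop (𝓝[≥] (σ ω)) := by
  classical
  have : Nonempty (TimeInterval T) := ⟨t⟩
  let d := TopologicalSpace.denseSeq (TimeInterval T)
  let F : ℕ → Finset (TimeInterval T) := fun n => insert t ((Finset.range n).image d)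
  have hmin : ∀ n ω, ∃ y ∈ F n, σ ω ≤ y ∧ ∀ z ∈ F n, σ ω ≤ z → y ≤ z := by
    intro n ω
    have hne : ((F n).filter (σ ω ≤ ·)).Nonempty :=
      ⟨t, Finset.mem_filter.2 ⟨Finset.mem_insert_self _ _, hσt ω⟩⟩
    have h := Finset.mem_filter.1 (Finset.min'_mem _ hne)
    exact ⟨_, h.1, h.2, fun z hz hz' => Finset.min'_le _ _ (Finset.mem_filter.2 ⟨hz, hz'⟩)⟩
  choose σ' hF hle hmin using hmin
  have ht : ∀ n ω, σ' n ω ≤ t := fun n ω => hmin n ω t (Finset.mem_insert_self _ _) (hσt ω)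
  refine ⟨F, σ', fun n ω => ⟨hF n ω, hle n ω, ht n ω⟩, fun n u A hA => ?_, fun ω => ?_⟩
  · have hA' : ∀ v ≤ u, MeasurableSet[ℱ u] (A ∩ {ω | σ ω ≤ v}) := fun v hv =>
      ℱ.mono hv _ (by simpa using hA.2 v)
    by_cases hu : u ∈ F n
    -- The least grid point above `σ` is `u` exactly when `σ ≤ u` but `σ ≤ v` fails for each smaller
    -- grid point `v`.
    · have : A ∩ {ω | σ' n ω = u} =
          (A ∩ {ω | σ ω ≤ u}) \ ⋃ v ∈ (F n).filter (· < u), A ∩ {ω | σ ω ≤ v} := by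
        ext ω
        simp only [mem_inter_iff, mem_ofPred_eq, Set.mem_sdiff, mem_iUnion, Finset.mem_filter,
          exists_prop, not_exists, not_and]
        constructor
        · rintro ⟨hωA, rfl⟩
          exact ⟨⟨hωA, hle n ω⟩, fun v hv _ hv' => hv.2.not_ge (hmin n ω v hv.1 hv')⟩
        · rintro ⟨⟨hωA, h1⟩, h2⟩
          refine ⟨hωA, le_antisymm (hmin n ω u hu h1) ?_⟩
          by_contra! hlt
          exact h2 _ ⟨hF n ω, hlt⟩ hωA (hle n ω)
      rw [this]
      refine MeasurableSet.diff (hA' u le_rfl) ?_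
      exact MeasurableSet.biUnion (Finset.countable_toSet _) fun v hv =>
        hA' v (Finset.mem_filter.1 hv).2.le
    · have : A ∩ {ω | σ' n ω = u} = ∅ := by
        ext ω
        simp only [mem_inter_iff, mem_ofPred_eq, mem_empty_iff_false, iff_false, not_and]
        rintro - rfl
        exact hu (hF n ω)
      rw [this]
      exact @MeasurableSet.empty Ω (ℱ u)
  · refine tendsto_nhdsWithin_iff.2 ⟨?_, Eventually.of_forall fun n => hle n ω⟩
    refine tendsto_order.2 ⟨fun w hw => Eventually.of_forall fun n => hw.trans_le (hle n ω),
      fun w hw => ?_⟩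
    rcases (hσt ω).eq_or_lt with h | h
    · exact Eventually.of_forall fun n => (ht n ω).trans_lt (h ▸ hw)
    · obtain ⟨_, ⟨k, rfl⟩, hk⟩ :=
        (TopologicalSpace.denseRange_denseSeq (TimeInterval T)).exists_between hw
      refine eventually_atTop.2 ⟨k + 1, fun n hn => ?_⟩
      refine (hmin n ω (d k) (Finset.mem_insert_of_mem (Finset.mem_image_of_mem _ ?_))
        hk.1.le).trans_lt hk.2
      exact Finset.mem_range.2 hn

lemma measurable_enorm_sub_finite (hV : StronglyAdapted ℱ V) {F : Finset (TimeInterval T)}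
    (hF : ∀ ω, σ ω ∈ F) (hσ : ∀ u, MeasurableSet {ω | σ ω = u}) :
    Measurable fun ω => ‖V t ω - V (σ ω) ω‖ₑ := by
  have : (fun ω => ‖V t ω - V (σ ω) ω‖ₑ) =
      fun ω => ∑ u ∈ F, {ω | σ ω = u}.indicator (fun ω => ‖V t ω - V u ω‖ₑ) ω := by
    ext ω
    rw [Finset.sum_eq_single_of_mem (σ ω) (hF ω) fun u _ hu =>
      indicator_of_notMem (by simpa using hu.symm) _]
    simp
  rw [this]
  refine Finset.measurable_sum _ fun u _ => Measurable.indicator ?_ (hσ u)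
  exact (((hV t).mono (ℱ.le t)).sub ((hV u).mono (ℱ.le u))).enorm

lemma tendsto_enorm_sub_approximation (hx : IsCadlagProcess P V) {σ' : ℕ → Ω → TimeInterval T}
    (hσ' : ∀ ω, Tendsto (fun n => σ' n ω) atTop (𝓝[≥] (σ ω))) :
    ∀ᵐ ω ∂P, Tendsto (fun n => ‖V t ω - V (σ' n ω) ω‖ₑ) atTop (𝓝 ‖V t ω - V (σ ω) ω‖ₑ) := by
  filter_upwards [hx] with ω hω
  exact ((continuous_enorm.tendsto _).comp
    (((hω (σ ω)).1.tendsto.comp (hσ' ω)).const_sub (V t ω)) :)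

lemma aemeasurable_enorm_sub (hV : StronglyAdapted ℱ V) (hx : IsCadlagProcess P V)
    (hσ : IsStoppingTime ℱ fun ω => (σ ω : WithTop (TimeInterval T))) (hσt : ∀ ω, σ ω ≤ t) :
    AEMeasurable (fun ω => ‖V t ω - V (σ ω) ω‖ₑ) P := by
  obtain ⟨F, σ', h1, h2, h3⟩ := exists_finite_approximation hσ hσt
  refine aemeasurable_of_tendsto_metrizable_ae atTop (fun n => ?_)
    (tendsto_enorm_sub_approximation hx h3)
  refine (measurable_enorm_sub_finite hV (fun ω => (h1 n ω).1) fun u => ?_).aemeasurable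
  simpa using ℱ.le u _ (h2 n u univ MeasurableSet.univ)

/-- A bound on conditional increments up to time `t` at deterministic times extends to stopping
times. -/
lemma setLIntegral_enorm_sub_le (hV : StronglyAdapted ℱ V) (hx : IsCadlagProcess P V)
    (hσ : IsStoppingTime ℱ fun ω => (σ ω : WithTop (TimeInterval T)))
    (hσst : ∀ ω, s ≤ σ ω ∧ σ ω ≤ t) {G : ℝ≥0∞}
    (hG : ∀ u ∈ Icc s t, ∀ B, MeasurableSet[ℱ u] B → ∫⁻ ω in B, ‖V t ω - V u ω‖ₑ ∂P ≤ G * P B)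
    {A : Set Ω} (hA : MeasurableSet[hσ.measurableSpace] A) :
    ∫⁻ ω in A, ‖V t ω - V (σ ω) ω‖ₑ ∂P ≤ G * P A := by
  obtain ⟨F, σ', h1, h2, h3⟩ := exists_finite_approximation hσ fun ω => (hσst ω).2
  have hmeas : ∀ n, Measurable fun ω => ‖V t ω - V (σ' n ω) ω‖ₑ := fun n => by
    refine measurable_enorm_sub_finite hV (fun ω => (h1 n ω).1) fun u => ?_
    simpa using ℱ.le u _ (h2 n u univ MeasurableSet.univ)
  -- On each level set of `σ' n` the hypothesis at a deterministic time applies; the pieces add up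
  -- to `P A`.
  have hbound : ∀ n, ∫⁻ ω in A, ‖V t ω - V (σ' n ω) ω‖ₑ ∂P ≤ G * P A := by
    intro n
    have hAU : A = ⋃ u ∈ F n, A ∩ {ω | σ' n ω = u} := by
      ext ω
      simp only [mem_iUnion, mem_inter_iff, mem_ofPred_eq, exists_prop]
      exact ⟨fun h => ⟨_, (h1 n ω).1, h, rfl⟩, fun ⟨_, _, h, _⟩ => h⟩
    have hdisj : Set.PairwiseDisjoint (F n : Set (TimeInterval T))
        fun u => A ∩ {ω | σ' n ω = u} := by
      intro u _ v _ huv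
      refine Set.disjoint_left.2 fun ω hu hv => huv ?_
      exact hu.2.symm.trans hv.2
    have hm : ∀ u ∈ F n, MeasurableSet (A ∩ {ω | σ' n ω = u}) :=
      fun u _ => ℱ.le u _ (h2 n u A hA)
    have hPA : P A = ∑ u ∈ F n, P (A ∩ {ω | σ' n ω = u}) := by
      conv_lhs => rw [hAU]
      exact measure_biUnion_finset hdisj hm
    conv_lhs => rw [hAU]
    rw [lintegral_biUnion_finset hdisj hm, hPA, Finset.mul_sum]
    refine Finset.sum_le_sum fun u hu => ?_
    rcases (A ∩ {ω | σ' n ω = u}).eq_empty_or_nonempty with h0 | ⟨ω₀, -, hω₀⟩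
    · simp [h0]
    · rw [mem_ofPred_eq] at hω₀
      have hu' : u ∈ Icc s t := by
        rw [← hω₀]
        exact ⟨(hσst ω₀).1.trans (h1 n ω₀).2.1, (h1 n ω₀).2.2⟩
      refine le_trans (le_of_eq ?_) (hG u hu' _ (h2 n u A hA))
      refine setLIntegral_congr_fun (hm u hu) fun ω hω => ?_
      have : σ' n ω = u := hω.2
      simp only [this]
  calc ∫⁻ ω in A, ‖V t ω - V (σ ω) ω‖ₑ ∂P
      = ∫⁻ ω in A, liminf (fun n => ‖V t ω - V (σ' n ω) ω‖ₑ) atTop ∂P := by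
        refine lintegral_congr_ae (ae_restrict_of_ae ?_)
        filter_upwards [tendsto_enorm_sub_approximation hx h3] with ω hω
        exact hω.liminf_eq.symm
    _ ≤ liminf (fun n => ∫⁻ ω in A, ‖V t ω - V (σ' n ω) ω‖ₑ ∂P) atTop :=
        lintegral_liminf_le hmeas
    _ ≤ G * P A := by
        refine (liminf_le_liminf (Eventually.of_forall hbound)).trans_eq ?_
        simp

lemma meanVariation_le [IsProbabilityMeasure P] (hV : StronglyAdapted ℱ V)
    (hx : IsCadlagProcess P V) {q : ℝ} (hq : 1 ≤ q) :
    meanVariation ℱ P V s t ≤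
      2 * (⨆ u ∈ Icc s t, condNorm ℱ P q ∞ u (V t - V u)) + eLpNorm (jumpSup V s t) ∞ P := by
  set G := ⨆ u ∈ Icc s t, condNorm ℱ P q ∞ u (V t - V u) with hGdef
  have hq0 : 0 < q := by linarith
  have hG : ∀ u ∈ Icc s t, ∀ B, MeasurableSet[ℱ u] B →
      ∫⁻ ω in B, ‖V t ω - V u ω‖ₑ ∂P ≤ G * P B := by
    intro u hu B hB
    refine setLIntegral_le_of_setLIntegral_rpow_le
      (((hV t).mono (ℱ.le t)).sub ((hV u).mono (ℱ.le u))).enorm.aemeasurable hq ?_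
    refine (setLIntegral_le_eLpNorm_condLExp (ℱ.le u) _ hB).trans ?_
    gcongr
    have h : condNorm ℱ P q ∞ u (V t - V u) ≤ G := le_iSup₂_of_le u hu le_rfl
    rw [condNorm] at h
    rwa [one_div, ENNReal.rpow_inv_le_iff hq0] at h
  refine iSup_le fun σ => iSup_le fun τ => iSup_le fun hσ => iSup_le fun hτ => iSup_le fun h => ?_
  refine eLpNorm_condLExp_le hσ.measurableSpace_le fun A hA => ?_
  -- This allows the same `A` to test the increment from `τ` to `t`.
  have hAτ : MeasurableSet[hτ.measurableSpace] A :=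
    IsStoppingTime.measurableSpace_mono hσ hτ (fun ω => by simpa using (h ω).2.1) _ hA
  have hσt : ∀ ω, σ ω ≤ t := fun ω => (h ω).2.1.trans (h ω).2.2
  have hpt : ∀ᵐ ω ∂P, ‖V (τ ω) ω - leftValue V (σ ω) ω‖ₑ ≤
      ‖V t ω - V (τ ω) ω‖ₑ + (‖V t ω - V (σ ω) ω‖ₑ + eLpNorm (jumpSup V s t) ∞ P) := by
    rw [eLpNorm_exponent_top]
    filter_upwards [ENNReal.ae_le_essSup fun ω => ‖jumpSup V s t ω‖ₑ] with ω hω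
    have hj : ‖V (σ ω) ω - leftValue V (σ ω) ω‖ₑ ≤ eLpNormEssSup (jumpSup V s t) P :=
      le_trans (le_iSup₂_of_le (f := fun u (_ : u ∈ Icc s t) => ‖V u ω - leftValue V u ω‖ₑ)
        (σ ω) ⟨(h ω).1, hσt ω⟩ le_rfl) hω
    have e : V (τ ω) ω - leftValue V (σ ω) ω =
        -(V t ω - V (τ ω) ω) + ((V t ω - V (σ ω) ω) + (V (σ ω) ω - leftValue V (σ ω) ω)) := by
      abel
    rw [e]
    refine (enorm_add_le _ _).trans ?_
    rw [enorm_neg]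
    gcongr
    exact (enorm_add_le _ _).trans (by gcongr)
  have hm1 := aemeasurable_enorm_sub hV hx hτ fun ω => (h ω).2.2
  have hm2 := aemeasurable_enorm_sub hV hx hσ hσt
  calc ∫⁻ ω in A, ‖V (τ ω) ω - leftValue V (σ ω) ω‖ₑ ∂P
      ≤ ∫⁻ ω in A, ‖V t ω - V (τ ω) ω‖ₑ +
          (‖V t ω - V (σ ω) ω‖ₑ + eLpNorm (jumpSup V s t) ∞ P) ∂P :=
        lintegral_mono_ae (ae_restrict_of_ae hpt)
    _ = ∫⁻ ω in A, ‖V t ω - V (τ ω) ω‖ₑ ∂P + (∫⁻ ω in A, ‖V t ω - V (σ ω) ω‖ₑ ∂P +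
          eLpNorm (jumpSup V s t) ∞ P * P A) := by
        rw [lintegral_add_left' hm1.restrict, lintegral_add_left' hm2.restrict, setLIntegral_const]
    _ ≤ G * P A + (G * P A + eLpNorm (jumpSup V s t) ∞ P * P A) := by
        gcongr
        · exact setLIntegral_enorm_sub_le hV hx hτ
            (fun ω => ⟨(h ω).1.trans (h ω).2.1, (h ω).2.2⟩) hG hAτ
        · exact setLIntegral_enorm_sub_le hV hx hσ (fun ω => ⟨(h ω).1, hσt ω⟩) hG hA
    _ = (2 * G + eLpNorm (jumpSup V s t) ∞ P) * P A := by ring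

end LowerBound

/-! ### Superadditivity and Minkowski's inequality for `p`-variation -/

section PVariation

variable {T : ℝ} {p : ℝ} {F G : TimeInterval T → TimeInterval T → ℝ≥0∞} {s u t : TimeInterval T}

/-- `x` is a partition `s = x₀ < ⋯ < xₙ = t`. -/
def IsPartition (s t : TimeInterval T) (x : Σ n : ℕ, (Fin (n + 1) → TimeInterval T)) : Prop :=
  StrictMono x.2 ∧ x.2 0 = s ∧ x.2 (Fin.last x.1) = t

/-- The sum of the `p`-th powers of `F` along `x`. -/
noncomputable def powSum (p : ℝ) (F : TimeInterval T → TimeInterval T → ℝ≥0∞)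
    (x : Σ n : ℕ, (Fin (n + 1) → TimeInterval T)) : ℝ≥0∞ :=
  ∑ i : Fin x.1, F (x.2 i.castSucc) (x.2 i.succ) ^ p

/-- The supremum of the `p`-th power sums over partitions of `[s,t]`. -/
noncomputable def pVariationPow (p : ℝ) (F : TimeInterval T → TimeInterval T → ℝ≥0∞)
    (s t : TimeInterval T) : ℝ≥0∞ :=
  ⨆ (x) (_ : IsPartition s t x), powSum p F x

lemma pVariation_eq : pVariation p F s t = pVariationPow p F s t ^ (1 / p) := by
  rw [pVariationPow, iSup_sigma]
  rfl

lemma powSum_le_pVariationPow {x : Σ n : ℕ, (Fin (n + 1) → TimeInterval T)}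
    (hx : IsPartition s t x) : powSum p F x ≤ pVariationPow p F s t :=
  le_iSup₂_of_le x hx le_rfl

lemma powSum_rpow_le_pVariation (hp : 0 ≤ p) {x : Σ n : ℕ, (Fin (n + 1) → TimeInterval T)}
    (hx : IsPartition s t x) : powSum p F x ^ (1 / p) ≤ pVariation p F s t := by
  rw [pVariation_eq]
  exact ENNReal.rpow_le_rpow (powSum_le_pVariationPow hx) (by positivity)

lemma pVariation_le (hp : 0 < p) {c : ℝ≥0∞}
    (h : ∀ x, IsPartition s t x → powSum p F x ^ (1 / p) ≤ c) : pVariation p F s t ≤ c := by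
  rw [pVariation_eq, one_div, ENNReal.rpow_inv_le_iff hp]
  refine iSup₂_le fun x hx => ?_
  rw [← ENNReal.rpow_inv_le_iff hp, ← one_div]
  exact h x hx

lemma pVariation_le_const_mul (hp : 0 < p) (K : ℝ≥0∞) (h : ∀ u v, u < v → F u v ≤ K * G u v) :
    pVariation p F s t ≤ K * pVariation p G s t := by
  refine pVariation_le hp fun x hx => ?_
  calc powSum p F x ^ (1 / p)
      ≤ (∑ i : Fin x.1, (K * G (x.2 i.castSucc) (x.2 i.succ)) ^ p) ^ (1 / p) := by
        rw [powSum]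
        gcongr with i
        exact h _ _ (hx.1 i.castSucc_lt_succ)
    _ = K * powSum p G x ^ (1 / p) := by
        simp_rw [ENNReal.mul_rpow_of_nonneg _ _ hp.le]
        rw [← Finset.mul_sum, ENNReal.mul_rpow_of_nonneg _ _ (by positivity), ← ENNReal.rpow_mul,
          mul_one_div_cancel hp.ne', ENNReal.rpow_one, powSum]
    _ ≤ _ := by gcongr; exact powSum_rpow_le_pVariation hp.le hx

lemma isPartition_pair (h : s < t) : IsPartition s t ⟨1, ![s, t]⟩ := by
  refine ⟨Fin.strictMono_iff_lt_succ.2 fun i => ?_, rfl, rfl⟩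
  fin_cases i
  simpa using h

lemma rpow_le_pVariationPow (h : s < t) : F s t ^ p ≤ pVariationPow p F s t := by
  simpa [powSum] using powSum_le_pVariationPow (p := p) (F := F) (isPartition_pair h)

/-- Concatenation of two partitions. -/
lemma exists_concat {x y : Σ n : ℕ, (Fin (n + 1) → TimeInterval T)} (hx : IsPartition s u x)
    (hy : IsPartition u t y) :
    ∃ z, IsPartition s t z ∧ powSum p F z = powSum p F x + powSum p F y := by
  obtain ⟨m, a⟩ := x
  obtain ⟨n, b⟩ := y
  obtain ⟨ha, ha0, ham⟩ := hx
  obtain ⟨hb, hb0, hbn⟩ := hy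
  dsimp only at a b ha ha0 ham hb hb0 hbn
  let c : Fin (m + n + 1) → TimeInterval T := fun i =>
    if h : i.1 ≤ m then a ⟨i.1, by omega⟩ else b ⟨i.1 - m, by omega⟩
  have c1 : ∀ i : Fin m, c (Fin.castAdd n i).castSucc = a i.castSucc := fun i => by
    have : (i : ℕ) ≤ m := i.2.le
    simp [c, this, Fin.castSucc, Fin.castAdd, Fin.castLE]
  have c2 : ∀ i : Fin m, c (Fin.castAdd n i).succ = a i.succ := fun i => by
    have : (i : ℕ) + 1 ≤ m := i.2
    simp only [c, Fin.val_succ, Fin.val_castAdd, this, dite_true]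
    rfl
  have c3 : ∀ i : Fin n, c (Fin.natAdd m i).castSucc = b i.castSucc := fun i => by
    -- The shared endpoint is stored as the last point of `a`, so index `0` of `b` is separate.
    rcases Nat.eq_zero_or_pos i.1 with h | h
    · have e : i.castSucc = 0 := Fin.ext h
      have e' : (⟨m, by omega⟩ : Fin (m + 1)) = Fin.last m := rfl
      simp [c, e, e', ham, hb0]
    · have : ¬ (m + i.1 ≤ m) := by omega
      simp only [c, Fin.val_castSucc, Fin.val_natAdd, this, dite_false]
      congr 1
      ext
      simp
  have c4 : ∀ i : Fin n, c (Fin.natAdd m i).succ = b i.succ := fun i => by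
    have : ¬ (m + i.1 + 1 ≤ m) := by omega
    simp only [c, Fin.val_succ, Fin.val_natAdd, this, dite_false]
    congr 1
    ext
    simp
    omega
  have c0 : c 0 = s := by
    simp only [c, Fin.val_zero, Nat.zero_le]
    exact ha0
  have cl : c (Fin.last (m + n)) = t := by
    rcases n with _ | n
    · have e' : (⟨m, by omega⟩ : Fin (m + 1)) = Fin.last m := rfl
      simp only [c, Fin.val_last, add_zero, le_refl, dite_true, e', ham]
      exact hb0.symm.trans hbn
    · exact (c4 (Fin.last n)).trans hbn
  refine ⟨⟨m + n, c⟩, ⟨Fin.strictMono_iff_lt_succ.2 fun i => ?_, c0, cl⟩, ?_⟩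
  · refine Fin.addCases (fun i => ?_) (fun i => ?_) i
    · simp only [c1, c2]
      exact ha i.castSucc_lt_succ
    · simp only [c3, c4]
      exact hb i.castSucc_lt_succ
  · simp only [powSum, Fin.sum_univ_add, c1, c2, c3, c4]

lemma pVariationPow_add_le (hsu : s < u) (hut : u < t) :
    pVariationPow p F s u + pVariationPow p F u t ≤ pVariationPow p F s t := by
  refine ENNReal.biSup_add_biSup_le' ⟨_, isPartition_pair hsu⟩ ⟨_, isPartition_pair hut⟩
    fun x hx y hy => ?_
  obtain ⟨z, hz, h⟩ := exists_concat (p := p) (F := F) hx hy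
  exact h ▸ powSum_le_pVariationPow hz

lemma sum_pVariationPow_le (n : ℕ) (π : Fin (n + 1) → TimeInterval T) (hπ : StrictMono π) :
    ∑ i : Fin n, pVariationPow p F (π i.castSucc) (π i.succ) ≤
      pVariationPow p F (π 0) (π (Fin.last n)) := by
  induction n with
  | zero => simp
  | succ n ih =>
    -- Superadditivity needs two nondegenerate intervals, so a single cell is treated apart.
    rcases Nat.eq_zero_or_pos n with rfl | hn
    · simp
    rw [Fin.sum_univ_castSucc]
    refine (add_le_add_left (ih (fun i => π i.castSucc)
      (hπ.comp Fin.strictMono_castSucc)) _).trans ?_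
    refine pVariationPow_add_le (hπ ?_) (hπ ?_)
    · rw [Fin.lt_def]
      simpa using hn
    · rw [Fin.lt_def]
      simp

/-- Replacing `F s t` by the supremum of `F u t` over `u ∈ [s,t]` does not increase the
`p`-variation, when `F` vanishes on the diagonal. -/
lemma pVariation_iSup_le (hp : 0 < p) (hF : ∀ u, F u u = 0) :
    pVariation p (fun s t => ⨆ u ∈ Icc s t, F u t) s t ≤ pVariation p F s t := by
  refine pVariation_le hp fun x hx => ?_
  rw [pVariation_eq]
  gcongr
  rw [← hx.2.1, ← hx.2.2]
  -- It suffices to compare cell by cell: `[u,v]` is one cell of a partition of any larger interval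
  -- ending at `v`.
  refine le_trans ?_ (sum_pVariationPow_le x.1 x.2 hx.1)
  refine Finset.sum_le_sum fun i _ => ?_
  have hlt := hx.1 i.castSucc_lt_succ
  rw [← ENNReal.le_rpow_inv_iff hp]
  refine iSup₂_le fun u hu => ?_
  rw [ENNReal.le_rpow_inv_iff hp]
  rcases hu.2.eq_or_lt with rfl | hut
  · simp [hF, hp]
  rcases hu.1.eq_or_lt with rfl | hsu
  · exact rpow_le_pVariationPow hut
  · exact (rpow_le_pVariationPow hut).trans (le_add_self.trans (pVariationPow_add_le hsu hut))

/-- Minkowski's inequality along each partition; this is where `p ≥ 1` enters. -/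
lemma pVariation_add_le (hp : 1 ≤ p) :
    pVariation p (fun s t => F s t + G s t) s t ≤ pVariation p F s t + pVariation p G s t := by
  have hp0 : 0 < p := by linarith
  refine pVariation_le hp0 fun x hx => (ENNReal.Lp_add_le _ _ _ hp).trans ?_
  exact add_le_add (powSum_rpow_le_pVariation hp0.le hx) (powSum_rpow_le_pVariation hp0.le hx)

lemma pVariation_mono (hp : 0 < p) (h : ∀ u v, u < v → F u v ≤ G u v) :
    pVariation p F s t ≤ pVariation p G s t := by
  simpa using pVariation_le_const_mul (s := s) (t := t) (F := F) (G := G) hp 1 (by simpa using h)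

end PVariation

/-! ### Comparison of the three norms -/

section Comparison

variable {T : ℝ} {Ω E : Type*} {mΩ : MeasurableSpace Ω} [NormedAddCommGroup E]
  {V : TimeInterval T → Ω → E} {s t : TimeInterval T}
  {ℱ : Filtration (TimeInterval T) mΩ} {P : Measure Ω} [IsProbabilityMeasure P] {p q : ℝ}

omit [IsProbabilityMeasure P] in
lemma condNorm_zero [IsFiniteMeasure P] (hq : 0 < q) (r : ℝ≥0∞) (s : TimeInterval T) :
    condNorm ℱ P q r s (0 : Ω → E) = 0 := by
  have h : (fun ω => ‖(0 : Ω → E) ω‖ₑ ^ q) = 0 := by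
    ext ω
    simp [hq]
  rw [condNorm, h, condLExp_zero, eLpNorm_zero]
  simp [hq]

lemma bmoNorm_le (hV : StronglyAdapted ℱ V) (hx : IsCadlagProcess P V) (hp : 1 ≤ p)
    (hq : 1 ≤ q) :
    bmoNorm ℱ P p V s t ≤ 2 * pqrNorm ℱ P p q ∞ V s t + pInftyNorm P p (jumpSup V) s t := by
  have hp0 : 0 < p := by linarith
  refine (pVariation_mono hp0 fun u v _ => meanVariation_le hV hx hq).trans ?_
  refine (pVariation_add_le hp).trans ?_
  refine add_le_add ?_ le_rfl
  refine (pVariation_le_const_mul (G := fun s t => ⨆ u ∈ Icc s t, condNorm ℱ P q ∞ u (V t - V u))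
    hp0 2 fun u v _ => le_rfl).trans ?_
  gcongr
  refine pVariation_iSup_le (F := fun u v => condNorm ℱ P q ∞ u (V v - V u)) hp0 fun u => ?_
  rw [sub_self]
  exact condNorm_zero (by linarith) _ _

lemma pqrNorm_le (hℱ : ℱ.IsRightContinuous) (hV : StronglyAdapted ℱ V)
    (hx : IsCadlagProcess P V) (hp : 0 < p) (hq : 0 < q) :
    pqrNorm ℱ P p q ∞ V s t ≤ johnNirenbergConst q ^ (1 / q) * bmoNorm ℱ P p V s t :=
  pVariation_le_const_mul hp _ fun _ _ huv => condNorm_le_meanVariation hℱ hV hx huv hq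

lemma pInftyNorm_jumpSup_le (hℱ : ℱ.IsRightContinuous) (hV : StronglyAdapted ℱ V)
    (hx : IsCadlagProcess P V) (hp : 0 < p) :
    pInftyNorm P p (jumpSup V) s t ≤ bmoNorm ℱ P p V s t :=
  pVariation_mono hp fun _ _ huv => eLpNorm_jumpSup_le_meanVariation hℱ hV hx huv.le

end Comparison

end BMOVar

theorem mainTheorem11 (q : ℝ) (hq : 1 ≤ q) :
    ∃ C : ℝ≥0, 0 < C ∧
      ∀ (p : ℝ), 1 ≤ p → ∀ (T : ℝ) (hT : 0 < T)
        (Ω : Type*) (mΩ : MeasurableSpace Ω) (P : Measure Ω) (_ : IsProbabilityMeasure P)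
        (ℱ : Filtration (BMOVar.TimeInterval T) mΩ) (_ : BMOVar.UsualConditions ℱ P)
        (E : Type*) (_ : NormedAddCommGroup E) (_ : NormedSpace ℝ E)
        (V : BMOVar.TimeInterval T → Ω → E),
        BMOVar.IsCadlagProcess P V → StronglyAdapted ℱ V →
        MemLp (V (BMOVar.startTime hT)) (ENNReal.ofReal q) P →
          (1 / 5 * BMOVar.bmoNorm ℱ P p V (BMOVar.startTime hT) (BMOVar.endTime hT)
              ≤ BMOVar.pqrNorm ℱ P p q ∞ V (BMOVar.startTime hT) (BMOVar.endTime hT)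
                + BMOVar.pInftyNorm P p (BMOVar.jumpSup V)
                    (BMOVar.startTime hT) (BMOVar.endTime hT) ∧
            BMOVar.pqrNorm ℱ P p q ∞ V (BMOVar.startTime hT) (BMOVar.endTime hT)
                + BMOVar.pInftyNorm P p (BMOVar.jumpSup V)
                    (BMOVar.startTime hT) (BMOVar.endTime hT)
              ≤ C * BMOVar.bmoNorm ℱ P p V (BMOVar.startTime hT) (BMOVar.endTime hT)) ∧
          (BMOVar.MemBMO hT ℱ P p V ↔
            BMOVar.MemVpLqr hT ℱ P p q ∞ V ∧
              BMOVar.pInftyNorm P p (BMOVar.jumpSup V)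
                (BMOVar.startTime hT) (BMOVar.endTime hT) < ∞) := by
  have hq0 : 0 < q := by linarith
  have hK : BMOVar.johnNirenbergConst q ^ (1 / q) ≠ ∞ :=
    ENNReal.rpow_ne_top_of_nonneg (by positivity) (BMOVar.johnNirenbergConst_ne_top hq0.le)
  -- The first summand pays for the increments, the `1` for the jumps.
  refine ⟨(BMOVar.johnNirenbergConst q ^ (1 / q)).toNNReal + 1, by positivity, ?_⟩
  intro p hp T hT Ω mΩ P _ ℱ hℱ E _ _ V hx hV h0
  have hp0 : 0 < p := by linarith
  have hlow := BMOVar.bmoNorm_le (s := BMOVar.startTime hT) (t := BMOVar.endTime hT) hV hx hp hq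
  have hup1 := BMOVar.pqrNorm_le (s := BMOVar.startTime hT) (t := BMOVar.endTime hT)
    hℱ.rightContinuous hV hx hp0 hq0
  have hup2 := BMOVar.pInftyNorm_jumpSup_le (s := BMOVar.startTime hT) (t := BMOVar.endTime hT)
    hℱ.rightContinuous hV hx hp0
  refine ⟨⟨?_, ?_⟩, fun h => ⟨⟨hx, h0, ?_⟩, hup2.trans_lt h.finite⟩, fun h => ⟨hx, hV, ?_⟩⟩
  · rw [one_div, mul_comm, ← div_eq_mul_inv]
    refine ENNReal.div_le_of_le_mul' (hlow.trans ?_)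
    rw [mul_add]
    gcongr
    · norm_num
    · exact le_mul_of_one_le_left' (by norm_num)
  · rw [ENNReal.coe_add, ENNReal.coe_toNNReal hK, ENNReal.coe_one, add_mul, one_mul]
    exact add_le_add hup1 hup2
  · exact hup1.trans_lt (ENNReal.mul_lt_top hK.lt_top h.finite)
  · exact hlow.trans_lt
      (ENNReal.add_lt_top.2 ⟨ENNReal.mul_lt_top (by simp) h.1.finite, h.2⟩)
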